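/- Fix $\alpha>1$. A job sequence is a finite set of jobs with distinct ids; job $j$ has a release time $r(j)\ge 0$ and a work requirement $p(j)>0$. A single processor processes $s$ units of work and uses $P(s)=s^\alpha$ units of energy per unit time when it runs at speed $s\in[0,\infty)$; preemption is free, and the speed may be divided among several jobs. In a schedule, a job is *active* at time $t$ if it is released by time $t$ but not completed by time $t$; only active jobs are processed. The flow time of a job is the time from its release to its completion, and the cost of a schedule is its total flow time $\sum_j F(j)$ plus its energy $\int_0^\infty s(t)^\alpha\,dt$. An algorithm is $c$-competitive ($c\ge 1$) for total flow time plus energy if, for every job sequence $I$, the cost of the schedule it produces for $I$ is at most $c$ times the minimum (infimum) cost over all schedules of $I$. The algorithm $\mathrm{LAPS}(\delta,\beta)$ does the following at every time $t$, where $n(t)$ is the number of its active jobs: it runs the processor at speed $(1+\delta)\,n(t)^{1/\alpha}$ and splits this speed equally among the $\lceil\beta n(t)\rceil$ active jobs with the latest release times, ties being broken by job ids. (It is nonclairvoyant: the rule does not use the work requirements of the active jobs.) **Theorem.** For every $\alpha>1$, $\delta=\frac{3}{\alpha}$ and $\beta=\frac1{2\alpha}$, the rule $\mathrm{LAPS}(\delta,\beta)$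 determines exactly one schedule for every job sequence, and the resulting algorithm is $c$-competitive for total flow time plus energy, where \[ c = 4\alpha^3\Bigl(1+\bigl(1+\tfrac{3}{\alpha}\bigr)^\alpha\Bigr) = O(\alpha^3), \] the constant in $O(\alpha^3)$ being the same for all $\alpha>1$. -/

import Mathlib

open scoped ENNReal

noncomputable section

namespace SpeedScaling

/-- A finite job sequence. Jobs are identified with their ids `0, …, size - 1`; job `j` is
released at time `release j` and requires `work j` units of work. -/
structure JobSequence where
  size : ℕ
  release : Fin size → ℝ
  work : Fin size → ℝ
  release_nonneg : ∀ j, 0 ≤ release j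
  work_pos : ∀ j, 0 < work j

/-- The amount of work done by time `t` on a job that is processed at rate `x u` at time `u`. -/
def workDone (x : ℝ → ℝ) (t : ℝ) : ℝ := ∫ u in (0 : ℝ)..t, x u

/-- A (preemptive, single processor) schedule of `I`: `rate j t` is the rate at which job `j` is
processed at time `t`. A job is processed only while it is active, that is, released but not yet
completed. Several jobs may share the processor. -/
@[ext]
structure Schedule (I : JobSequence) where
  rate : Fin I.size → ℝ → ℝ
  rate_nonneg : ∀ j t, 0 ≤ rate j t
  rate_integrable : ∀ j t, IntervalIntegrable (rate j) MeasureTheory.volume 0 t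
  rate_eq_zero : ∀ j t, ¬ (I.release j ≤ t ∧ workDone (rate j) t < I.work j) → rate j t = 0

namespace Schedule

variable {I : JobSequence}

/-- The speed of the processor at time `t`: the work processed per unit time. -/
def speed (S : Schedule I) (t : ℝ) : ℝ := ∑ j, S.rate j t

/-- Job `j` has been completed by time `t`. -/
def CompletedBy (S : Schedule I) (j : Fin I.size) (t : ℝ) : Prop :=
  I.work j ≤ workDone (S.rate j) t

open Classical in
/-- The set of active jobs at time `t`: released by time `t` but not completed by time `t`. -/
def active (S : Schedule I) (t : ℝ) : Finset (Fin I.size) :=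
  Finset.univ.filter fun j => I.release j ≤ t ∧ ¬ S.CompletedBy j t

/-- The flow time of job `j`: the time elapsed from its release until its completion
(`∞` if it is never completed). -/
def flowTime (S : Schedule I) (j : Fin I.size) : ℝ≥0∞ :=
  ⨅ (t : ℝ) (_ : I.release j ≤ t ∧ S.CompletedBy j t), ENNReal.ofReal (t - I.release j)

/-- The total flow time. -/
def totalFlow (S : Schedule I) : ℝ≥0∞ := ∑ j, S.flowTime j

/-- The energy used when the power function is `P(s) = s ^ α`. -/
def energy (α : ℝ) (S : Schedule I) : ℝ≥0∞ :=
  ∫⁻ t in Set.Ici (0 : ℝ), ENNReal.ofReal (S.speed t ^ α)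

/-- The objective: total flow time plus energy. -/
def cost (α : ℝ) (S : Schedule I) : ℝ≥0∞ := S.totalFlow + S.energy α

end Schedule

/-- The optimal offline cost: the infimum of the cost over all schedules of `I`. -/
def optCost (α : ℝ) (I : JobSequence) : ℝ≥0∞ := ⨅ S : Schedule I, S.cost α

/-- `ALG`, which produces the schedule `ALG I` for the job sequence `I`, is `c`-competitive for
total flow time plus energy. -/
def IsCompetitive (α c : ℝ) (ALG : (I : JobSequence) → Schedule I) : Prop :=
  1 ≤ c ∧ ∀ I : JobSequence, (ALG I).cost α ≤ ENNReal.ofReal c * optCost α I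

/-- Job `k` is later than job `j`: it has a later release time, ties being broken by job ids. -/
def Later {m : ℕ} (release : Fin m → ℝ) (k j : Fin m) : Prop :=
  release j < release k ∨ (release j = release k ∧ j < k)

open Classical in
/-- The `k` latest jobs of the set `A`: those jobs of `A` for which fewer than `k` jobs of `A`
are later. -/
def latest {m : ℕ} (release : Fin m → ℝ) (A : Finset (Fin m)) (k : ℕ) : Finset (Fin m) :=
  A.filter fun j => (A.filter fun i => Later release i j).card < k

/-- The schedule `S` follows LAPS(δ, β) at every time `t`: with `n` active jobs the speed is
`(1 + δ) n ^ (1 / α)`, and it is shared equally by the `⌈β n⌉` latest active jobs. -/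
structure FollowsLAPS (α δ β : ℝ) {I : JobSequence} (S : Schedule I) : Prop where
  speed_eq : ∀ t, S.speed t = (1 + δ) * ((S.active t).card : ℝ) ^ (1 / α)
  rate_eq_of_mem : ∀ t, ∀ j ∈ latest I.release (S.active t) ⌈β * ((S.active t).card : ℝ)⌉₊,
    S.rate j t = S.speed t / (⌈β * ((S.active t).card : ℝ)⌉₊ : ℝ)
  rate_eq_of_notMem : ∀ t, ∀ j ∉ latest I.release (S.active t) ⌈β * ((S.active t).card : ℝ)⌉₊,
    S.rate j t = 0

end SpeedScaling

end

/-!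
A schedule that follows LAPS changes its rates only when a job is released or completed. Keeping
the rates prescribed for the current active set until the next such event constructs the schedule
in finitely many steps; uniqueness is propagated from left to right.

Competitiveness follows from an amortized analysis of a schedule `S` of LAPS against any schedule
`O`. Weight the amount by which `S` lags behind `O` on job `j` by the `(1 - 1 / α)`-th power of the
rank of `j`, the number of uncompleted jobs that are not later than `j`. Let `n` and `m` be the
numbers of active jobs of `S` and `O`, and let `s` be the speed of `O`. The work of `O` increases
the weighted lag at rate at most `n ^ (1 - 1 / α) * s ≤ s ^ α / α + (1 - 1 / α) * n`. LAPS works on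
jobs of rank at least `(1 - β) * n`, and `S` lags behind on all of those that are not active in `O`;
this decreases the weighted lag at rate at least `K * n - K / β * m`, where
`K = (1 + δ) * (1 - β) ^ (1 - 1 / α)`. Since lags are nonnegative and vanish at time `0`, and the
weights are nonincreasing in time, the weighted lag rates have nonnegative integral. Hence `∫ n` is
at most a constant times `∫ (m + s ^ α)`, and these integrals are the flow time of `S` and the cost
of `O`.
-/

noncomputable section

open scoped Topology
open MeasureTheory Set Filter

namespace SpeedScaling

section Integration

variable {f g : ℝ → ℝ} {a b : ℝ}

theorem exists_inter_Ioc_ae_eq_of_isLowerSet {D : Set ℝ} (hD : IsLowerSet D) (hab : a ≤ b) :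
    ∃ c ∈ Icc a b, (D ∩ Ioc a b : Set ℝ) =ᵐ[volume] Ioc a c := by
  rcases (D ∩ Ioc a b).eq_empty_or_nonempty with hempty | hne
  · exact ⟨a, ⟨le_rfl, hab⟩, by simp [hempty]⟩
  have hbdd : BddAbove (D ∩ Ioc a b) := ⟨b, fun u hu => hu.2.2⟩
  have hupper : D ∩ Ioc a b ⊆ Ioc a (sSup (D ∩ Ioc a b)) :=
    fun u hu => ⟨hu.2.1, le_csSup hbdd hu⟩
  have hlower : Ioo a (sSup (D ∩ Ioc a b)) ⊆ D ∩ Ioc a b := fun u hu => by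
    obtain ⟨v, hv, huv⟩ := exists_lt_of_lt_csSup hne hu.2
    exact ⟨hD huv.le hv.1, hu.1, huv.le.trans hv.2.2⟩
  refine ⟨sSup (D ∩ Ioc a b), ⟨?_, csSup_le hne fun u hu => hu.2.2⟩,
    hupper.eventuallyLE.antisymm (Ioo_ae_eq_Ioc.symm.le.trans hlower.eventuallyLE)⟩
  obtain ⟨u, hu⟩ := hne
  exact (hupper hu).1.le.trans (hupper hu).2

theorem intervalIntegral_indicator_nonneg_of_isLowerSet (hab : a ≤ b)
    (hf : ∀ c ∈ Icc a b, 0 ≤ ∫ u in a..c, f u) {D : Set ℝ} (hD : IsLowerSet D) :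
    0 ≤ ∫ u in a..b, D.indicator f u := by
  obtain ⟨c, hc, hDc⟩ := exists_inter_Ioc_ae_eq_of_isLowerSet hD hab
  rw [intervalIntegral.integral_of_le hab, setIntegral_indicator hD.ordConnected.measurableSet,
    inter_comm, setIntegral_congr_set hDc, ← intervalIntegral.integral_of_le hc.1]
  exact hf c hc

theorem intervalIntegrable_antitone_mul (hab : a ≤ b) (hint : IntervalIntegrable f volume a b)
    {w : ℝ → ℝ} (hw : Antitone w) (hw0 : ∀ u, 0 ≤ w u) :
    IntervalIntegrable (fun u => w u * f u) volume a b := by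
  rw [intervalIntegrable_iff_integrableOn_Ioc_of_le hab] at hint ⊢
  refine hint.bdd_mul (c := w a) hw.measurable.aestronglyMeasurable ?_
  refine ae_restrict_of_forall_mem measurableSet_Ioc fun u hu => ?_
  rw [Real.norm_of_nonneg (hw0 u)]
  exact hw hu.1.le

theorem intervalIntegral_antitone_mul_nonneg (hab : a ≤ b) (hint : IntervalIntegrable f volume a b)
    (hf : ∀ c ∈ Icc a b, 0 ≤ ∫ u in a..c, f u) {w : ℝ → ℝ} (hw : Antitone w)
    (hw0 : ∀ u, 0 ≤ w u) : 0 ≤ ∫ u in a..b, w u * f u := by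
  -- The layer-cake formula for `w` reduces the claim to indicators of lower sets.
  let layer : ℝ → ℝ → ℝ := fun u s => {u | s ≤ w u}.indicator f u
  have hlayer : ∀ u ∈ uIcc a b, ∫ s in (0 : ℝ)..w a, layer u s = w u * f u := fun u hu => by
    rw [uIcc_of_le hab] at hu
    change ∫ s in (0 : ℝ)..w a, {s | s ≤ w u}.indicator (fun _ => f u) s = w u * f u
    rw [intervalIntegral.integral_indicator ⟨hw0 u, hw hu.1⟩]
    simp
  have hswap : IntegrableOn layer.uncurry (uIoc a b ×ˢ uIoc 0 (w a)) := by
    have hfst : IntegrableOn (fun q : ℝ × ℝ => f q.1) (uIoc a b ×ˢ uIoc 0 (w a)) := by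
      rw [uIoc_of_le (hw0 a), IntegrableOn, Measure.volume_eq_prod, ← Measure.prod_restrict]
      exact Integrable.comp_fst (intervalIntegrable_iff.1 hint) _
    exact hfst.indicator (measurableSet_le measurable_snd (hw.measurable.comp measurable_fst))
  calc 0 ≤ ∫ s in (0 : ℝ)..w a, ∫ u in a..b, layer u s :=
        intervalIntegral.integral_nonneg (hw0 a) fun s _ =>
          intervalIntegral_indicator_nonneg_of_isLowerSet hab hf
            fun _ _ hvu hs => le_trans hs (hw hvu)
    _ = ∫ u in a..b, ∫ s in (0 : ℝ)..w a, layer u s :=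
        (intervalIntegral_intervalIntegral_swap hswap).symm
    _ = ∫ u in a..b, w u * f u := intervalIntegral.integral_congr hlayer

theorem absolutelyContinuousOnInterval_max_const (hf : AbsolutelyContinuousOnInterval f a b)
    (c : ℝ) : AbsolutelyContinuousOnInterval (fun t => max (f t) c) a b := by
  rw [absolutelyContinuousOnInterval_iff] at hf ⊢
  intro ε hε
  obtain ⟨δ, hδ, h⟩ := hf ε hε
  refine ⟨δ, hδ, fun E hE hlen => (Finset.sum_le_sum fun i _ => ?_).trans_lt (h E hE hlen)⟩
  rw [Real.dist_eq, Real.dist_eq]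
  exact abs_max_sub_max_le_abs _ _ _

open Classical in
theorem deriv_max_const {f' x c : ℝ} (hf : HasDerivAt f f' x) :
    deriv (fun t => max (f t) c) x = if c < f x then f' else 0 := by
  rcases lt_trichotomy c (f x) with hgt | heq | hlt
  · have hmax : (fun t => max (f t) c) =ᶠ[𝓝 x] f := by
      filter_upwards [hf.continuousAt.eventually_const_lt hgt] with t ht
      exact max_eq_left ht.le
    rw [hmax.deriv_eq, hf.deriv, if_pos hgt]
  · have hmin : IsLocalMin (fun t => max (f t) c) x :=
      Eventually.of_forall fun t => by simp [← heq]
    rw [hmin.deriv_eq_zero, if_neg heq.not_lt]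
  · have hmax : (fun t => max (f t) c) =ᶠ[𝓝 x] fun _ => c := by
      filter_upwards [hf.continuousAt.eventually_lt_const hlt] with t ht
      exact max_eq_right ht.le
    rw [hmax.deriv_eq, deriv_const, if_neg hlt.not_gt]

theorem tendsto_ofReal_intervalIntegral_setLIntegral_Ici
    (hf : ∀ b, a ≤ b → IntervalIntegrable f volume a b) (hf0 : 0 ≤ f) :
    Tendsto (fun b => ENNReal.ofReal (∫ u in a..b, f u)) atTop
      (𝓝 (∫⁻ u in Ici a, ENNReal.ofReal (f u))) := by
  have hmeas : AEMeasurable (fun u => ENNReal.ofReal (f u)) (volume.restrict (Ioi a)) := by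
    refine AEMeasurable.ennreal_ofReal (aemeasurable_Ioi_of_forall_Ioc fun b hb => ?_)
    exact ((intervalIntegrable_iff_integrableOn_Ioc_of_le hb.le).1 (hf b hb.le)).aemeasurable
  have hlim := (aecover_Iic (μ := volume.restrict (Ioi a))
    tendsto_id).lintegral_tendsto_of_countably_generated hmeas
  rw [setLIntegral_congr Ioi_ae_eq_Ici.symm]
  refine hlim.congr' ?_
  filter_upwards [eventually_ge_atTop a] with b hab
  rw [Measure.restrict_restrict measurableSet_Iic, inter_comm, id, Ioi_inter_Iic,
    intervalIntegral.integral_of_le hab,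
    ofReal_integral_eq_lintegral_ofReal (hf b hab).1 (ae_of_all _ hf0)]

theorem setLIntegral_Ici_le_of_intervalIntegral_le
    (hf : ∀ b, a ≤ b → IntervalIntegrable f volume a b)
    (hg : ∀ b, a ≤ b → IntervalIntegrable g volume a b)
    (hf0 : 0 ≤ f) (hg0 : 0 ≤ g)
    (hle : ∀ b, a ≤ b → ∫ u in a..b, f u ≤ ∫ u in a..b, g u) :
    ∫⁻ u in Ici a, ENNReal.ofReal (f u) ≤ ∫⁻ u in Ici a, ENNReal.ofReal (g u) :=
  le_of_tendsto_of_tendsto (tendsto_ofReal_intervalIntegral_setLIntegral_Ici hf hf0)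
    (tendsto_ofReal_intervalIntegral_setLIntegral_Ici hg hg0) <| by
      filter_upwards [eventually_ge_atTop a] with b hab
      exact ENNReal.ofReal_le_ofReal (hle b hab)

end Integration

section WorkDone

variable {g h : ℝ → ℝ}

theorem workDone_zero (g : ℝ → ℝ) : workDone g 0 = 0 :=
  intervalIntegral.integral_same

theorem continuous_workDone (hg : ∀ a b, IntervalIntegrable g volume a b) :
    Continuous (workDone g) :=
  intervalIntegral.continuous_primitive hg 0

theorem workDone_add_integral (hg : ∀ a b, IntervalIntegrable g volume a b) (a b : ℝ) :
    workDone g a + ∫ u in a..b, g u = workDone g b :=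
  intervalIntegral.integral_add_adjacent_intervals (hg 0 a) (hg a b)

theorem monotone_workDone (hg : ∀ a b, IntervalIntegrable g volume a b) (hg0 : 0 ≤ g) :
    Monotone (workDone g) := fun a b hab => by
  rw [← workDone_add_integral hg a b]
  exact le_add_of_nonneg_right (intervalIntegral.integral_nonneg hab fun u _ => hg0 u)

theorem workDone_congr_of_lt {t T : ℝ} (hT : 0 ≤ T) (htT : t ≤ T) (hgh : ∀ u < T, g u = h u) :
    workDone g t = workDone h t := by
  refine intervalIntegral.integral_congr_ae ?_
  filter_upwards [Measure.ae_ne volume T] with u hu hmem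
  exact hgh u (lt_of_le_of_ne (hmem.2.trans (max_le hT htT)) hu)

theorem integral_indicator_workDone_pos (hg : ∀ a b, IntervalIntegrable g volume a b) (T : ℝ) :
    ∫ u in (0 : ℝ)..T, {u | 0 < workDone g u}.indicator g u = max (workDone g T) 0 := by
  have hac : AbsolutelyContinuousOnInterval (fun t => max (workDone g t) 0) 0 T :=
    absolutelyContinuousOnInterval_max_const
      ((hg 0 T).absolutelyContinuousOnInterval_intervalIntegral left_mem_uIcc) 0
  calc ∫ u in (0 : ℝ)..T, {u | 0 < workDone g u}.indicator g u
      = ∫ u in (0 : ℝ)..T, deriv (fun t => max (workDone g t) 0) u := by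
        refine intervalIntegral.integral_congr_ae ?_
        filter_upwards [(hg 0 T).ae_hasDerivAt_integral] with u hderiv hu
        have hderiv : HasDerivAt (workDone g) (g u) u :=
          hderiv (uIoc_subset_uIcc hu) 0 left_mem_uIcc
        rw [deriv_max_const hderiv]
        rfl
    _ = max (workDone g T) 0 := by
        rw [hac.integral_deriv_eq_sub, workDone_zero, max_self, sub_zero]

end WorkDone

section Dynamics

variable {I : JobSequence} {x y : Fin I.size → ℝ → ℝ} {f : Finset (Fin I.size) → Fin I.size → ℝ}
  {s t T : ℝ}

/-- Processing rates that are nonnegative and locally integrable. Unlike the rates of a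
`Schedule`, they may be positive on jobs that are not active, so that a rate can be continued
beyond the completion of a job before it is known when that completion occurs. -/
structure Admissible (x : Fin I.size → ℝ → ℝ) : Prop where
  nonneg : ∀ j, 0 ≤ x j
  intervalIntegrable : ∀ j a b, IntervalIntegrable (x j) volume a b

theorem Admissible.continuous_workDone (hx : Admissible x) (j : Fin I.size) :
    Continuous (workDone (x j)) :=
  SpeedScaling.continuous_workDone (hx.intervalIntegrable j)

theorem Admissible.monotone_workDone (hx : Admissible x) (j : Fin I.size) :
    Monotone (workDone (x j)) :=
  SpeedScaling.monotone_workDone (hx.intervalIntegrable j) (hx.nonneg j)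

open Classical in
/-- The jobs that are released but not completed at time `t` under arbitrary rates `x`; this is
`Schedule.active` when `x` are the rates of a schedule. -/
def activeSet (x : Fin I.size → ℝ → ℝ) (t : ℝ) : Finset (Fin I.size) :=
  Finset.univ.filter fun j => I.release j ≤ t ∧ workDone (x j) t < I.work j

theorem mem_activeSet {j : Fin I.size} :
    j ∈ activeSet x t ↔ I.release j ≤ t ∧ workDone (x j) t < I.work j := by
  simp [activeSet]

theorem activeSet_congr (hxy : ∀ j, workDone (x j) t = workDone (y j) t) :
    activeSet x t = activeSet y t := by
  ext j
  rw [mem_activeSet, mem_activeSet, hxy j]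

theorem activeSet_eq_empty_of_neg (x : Fin I.size → ℝ → ℝ) (ht : t < 0) : activeSet x t = ∅ :=
  Finset.eq_empty_of_forall_notMem fun j hj =>
    ((I.release_nonneg j).trans (mem_activeSet.1 hj).1).not_gt ht

theorem Admissible.eventually_activeSet_eq (hx : Admissible x) (T : ℝ) :
    ∀ᶠ t in 𝓝[≥] T, activeSet x t = activeSet x T := by
  have hjob : ∀ j, ∀ᶠ t in 𝓝[≥] T, (j ∈ activeSet x t ↔ j ∈ activeSet x T) := fun j => by
    simp only [mem_activeSet]
    rcases lt_or_ge T (I.release j) with hr | hr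
    · filter_upwards [nhdsWithin_le_nhds (eventually_lt_nhds hr)] with t ht
      simp only [ht.not_ge, hr.not_ge, false_and]
    rcases lt_or_ge (workDone (x j) T) (I.work j) with hw | hw
    · filter_upwards [nhdsWithin_le_nhds ((hx.continuous_workDone j).continuousAt.eventually_lt
        continuousAt_const hw), self_mem_nhdsWithin] with t ht hTt
      simp only [ht, hw, hr, hr.trans hTt]
    · filter_upwards [self_mem_nhdsWithin] with t hTt
      simp only [hw.not_gt, (hw.trans (hx.monotone_workDone j hTt)).not_gt, and_false]
  filter_upwards [eventually_all.2 hjob] with t ht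
  ext j
  exact ht j

theorem Admissible.activeSet_eq_or_exists_first_change (hx : Admissible x) (T : ℝ) :
    (∀ t, T ≤ t → activeSet x t = activeSet x T) ∨
      ∃ T', T ≤ T' ∧ (∀ t ∈ Ico T T', activeSet x t = activeSet x T) ∧
        activeSet x T' ≠ activeSet x T := by
  by_cases! hconst : ∀ t, T ≤ t → activeSet x t = activeSet x T
  · exact .inl hconst
  let changed : Set ℝ := {t | T ≤ t ∧ activeSet x t ≠ activeSet x T}
  have hinf : IsGLB changed (sInf changed) := isGLB_csInf hconst ⟨T, fun t ht => ht.1⟩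
  refine .inr ⟨sInf changed, hinf.2 fun t ht => ht.1, fun t ht => ?_, fun heq => ?_⟩
  · by_contra hne
    exact (hinf.1 ⟨ht.1, hne⟩).not_gt ht.2
  · obtain ⟨t, ht, hne⟩ := ((hinf.frequently_mem hconst).and_eventually
      (hx.eventually_activeSet_eq (sInf changed))).exists
    exact ht.2 (hne.trans heq)

open Classical in
/-- The number of releases and completions that are still to come after time `t`. -/
def pendingEvents (x : Fin I.size → ℝ → ℝ) (t : ℝ) : ℕ :=
  (Finset.univ.filter fun j => t < I.release j).card +
    (Finset.univ.filter fun j => workDone (x j) t < I.work j).card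

theorem pendingEvents_congr (hxy : ∀ j, workDone (x j) t = workDone (y j) t) :
    pendingEvents x t = pendingEvents y t := by
  simp only [pendingEvents, hxy]

theorem Admissible.pendingEvents_lt (hx : Admissible x) (hst : s ≤ t)
    (hne : activeSet x t ≠ activeSet x s) : pendingEvents x t < pendingEvents x s := by
  classical
  have hrelease : (Finset.univ.filter fun j => t < I.release j) ⊆
      Finset.univ.filter fun j => s < I.release j :=
    Finset.monotone_filter_right _ fun j _ => hst.trans_lt
  have hwork : (Finset.univ.filter fun j => workDone (x j) t < I.work j) ⊆
      Finset.univ.filter fun j => workDone (x j) s < I.work j :=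
    Finset.monotone_filter_right _ fun j _ => (hx.monotone_workDone j hst).trans_lt
  by_contra! hle
  have hcard₁ := Finset.card_le_card hrelease
  have hcard₂ := Finset.card_le_card hwork
  unfold pendingEvents at hle
  have heq₁ := Finset.eq_of_subset_of_card_le hrelease (by omega)
  have heq₂ := Finset.eq_of_subset_of_card_le hwork (by omega)
  refine hne (Finset.ext fun j => ?_)
  have hiff₁ := Finset.ext_iff.1 heq₁ j
  have hiff₂ := Finset.ext_iff.1 heq₂ j
  simp only [Finset.mem_filter, Finset.mem_univ, true_and] at hiff₁ hiff₂
  rw [mem_activeSet, mem_activeSet, hiff₂, ← not_lt, ← not_lt, hiff₁]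

/-- The rates `x` until time `T`, and the constant rates `c` from then on. -/
def switchAt (T : ℝ) (x : Fin I.size → ℝ → ℝ) (c : Fin I.size → ℝ) : Fin I.size → ℝ → ℝ :=
  fun j => (Iio T).piecewise (x j) fun _ => c j

theorem Admissible.switchAt (hx : Admissible x) {c : Fin I.size → ℝ} (hc : 0 ≤ c) (T : ℝ) :
    Admissible (switchAt T x c) where
  nonneg j t := by
    by_cases ht : t < T
    · simpa [SpeedScaling.switchAt, ht] using hx.nonneg j t
    · simpa [SpeedScaling.switchAt, ht] using hc j
  intervalIntegrable j a b := by
    rw [intervalIntegrable_iff]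
    exact Integrable.piecewise measurableSet_Iio
      (intervalIntegrable_iff.1 (hx.intervalIntegrable j a b)).integrableOn
      (intervalIntegrable_iff.1 (intervalIntegrable_const (μ := volume))).integrableOn

theorem workDone_switchAt (hT : 0 ≤ T) (htT : t ≤ T) (c : Fin I.size → ℝ) (j : Fin I.size) :
    workDone (switchAt T x c j) t = workDone (x j) t :=
  workDone_congr_of_lt hT htT fun _ hu => piecewise_eq_of_mem _ _ _ hu

/-- At every time in `s`, the rates `x` are those that the rule `f` prescribes for the set of
jobs that are active at that time. -/
def FollowsRuleOn (f : Finset (Fin I.size) → Fin I.size → ℝ) (x : Fin I.size → ℝ → ℝ)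
    (s : Set ℝ) : Prop :=
  ∀ t ∈ s, ∀ j, x j t = f (activeSet x t) j

theorem FollowsRuleOn.switchAt (hx : FollowsRuleOn f x (Iio T)) (hT : 0 ≤ T) :
    FollowsRuleOn f (switchAt T x (f (activeSet x T))) {t | T ≤ t →
      activeSet (switchAt T x (f (activeSet x T))) t = activeSet x T} := fun t ht j => by
  rcases lt_or_ge t T with htT | htT
  · rw [activeSet_congr fun j => workDone_switchAt hT htT.le _ j, ← hx t htT]
    exact piecewise_eq_of_mem _ _ _ htT
  · rw [ht htT]
    exact piecewise_eq_of_notMem _ _ _ (notMem_Iio.2 htT)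

theorem exists_followsRuleOn_univ_of_Iio (hf : ∀ A, 0 ≤ f A) (hT : 0 ≤ T) (hx : Admissible x)
    (hxf : FollowsRuleOn f x (Iio T)) :
    ∃ y : Fin I.size → ℝ → ℝ, Admissible y ∧ FollowsRuleOn f y univ := by
  induction hk : pendingEvents x T using Nat.strong_induction_on generalizing x T with
  | _ k ih =>
    let y := switchAt T x (f (activeSet x T))
    have hy : Admissible y := hx.switchAt (hf _) T
    have hyf := hxf.switchAt hT
    have hworkT : ∀ j, workDone (y j) T = workDone (x j) T := workDone_switchAt hT le_rfl _
    have hactT : activeSet y T = activeSet x T := activeSet_congr hworkT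
    rcases hy.activeSet_eq_or_exists_first_change T with hconst | ⟨T', hTT', hconst, hne⟩
    · exact ⟨y, hy, fun t _ => hyf t fun ht => (hconst t ht).trans hactT⟩
    · refine ih (pendingEvents y T') ?_ (hT.trans hTT') hy
        (fun t ht => hyf t fun hTt => (hconst t ⟨hTt, ht⟩).trans hactT) rfl
      rw [← hk, ← pendingEvents_congr hworkT]
      exact hy.pendingEvents_lt hTT' hne

theorem exists_followsRuleOn_univ (hf : ∀ A, 0 ≤ f A) (hf0 : ∀ A, ∀ j ∉ A, f A j = 0) :
    ∃ x : Fin I.size → ℝ → ℝ, Admissible x ∧ FollowsRuleOn f x univ := by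
  refine exists_followsRuleOn_univ_of_Iio (x := 0) (T := 0) hf le_rfl
    ⟨fun _ => le_rfl, fun _ _ _ => intervalIntegrable_const⟩ fun t ht j => ?_
  rw [activeSet_eq_empty_of_neg _ ht, hf0 ∅ j (Finset.notMem_empty j)]
  rfl

theorem FollowsRuleOn.eventually_workDone_eq (hx : Admissible x) (hy : Admissible y)
    (hxf : FollowsRuleOn f x univ) (hyf : FollowsRuleOn f y univ)
    (hT : ∀ j, workDone (x j) T = workDone (y j) T) :
    ∀ᶠ t in 𝓝[>] T, ∀ j, workDone (x j) t = workDone (y j) t := by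
  obtain ⟨v, hv, hconst⟩ := mem_nhdsGE_iff_exists_Ico_subset.1
    ((hx.eventually_activeSet_eq T).and (hy.eventually_activeSet_eq T))
  filter_upwards [Ioo_mem_nhdsGT hv] with t ht j
  rw [← workDone_add_integral (hx.intervalIntegrable j) T t,
    ← workDone_add_integral (hy.intervalIntegrable j) T t, hT j]
  refine congrArg _ (intervalIntegral.integral_congr fun u hu => ?_)
  rw [uIcc_of_le ht.1.le] at hu
  obtain ⟨hxu, hyu⟩ := hconst ⟨hu.1, hu.2.trans_lt ht.2⟩
  rw [hxf u (mem_univ u), hyf u (mem_univ u), hxu, hyu, activeSet_congr hT]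

theorem FollowsRuleOn.eq_of_univ (hx : Admissible x) (hy : Admissible y)
    (hxf : FollowsRuleOn f x univ) (hyf : FollowsRuleOn f y univ) : x = y := by
  have hclosed : IsClosed {t | ∀ j, workDone (x j) t = workDone (y j) t} := by
    simp only [ofPred_forall]
    exact isClosed_iInter fun j =>
      isClosed_eq (hx.continuous_workDone j) (hy.continuous_workDone j)
  have hwork : ∀ t, 0 ≤ t → ∀ j, workDone (x j) t = workDone (y j) t := fun t ht =>
    (hclosed.inter isClosed_Icc).Icc_subset_of_forall_mem_nhdsWithin (a := 0) (b := t)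
      (fun j => by rw [workDone_zero, workDone_zero])
      (fun u hu => hxf.eventually_workDone_eq hx hy hyf hu.1) ⟨ht, le_rfl⟩
  funext j t
  rw [hxf t (mem_univ t), hyf t (mem_univ t)]
  rcases lt_or_ge t 0 with ht | ht
  · rw [activeSet_eq_empty_of_neg x ht, activeSet_eq_empty_of_neg y ht]
  · rw [activeSet_congr (hwork t ht)]

theorem Schedule.active_eq_activeSet (S : Schedule I) (t : ℝ) :
    S.active t = activeSet S.rate t := by
  ext j
  simp [active, CompletedBy, mem_activeSet]

theorem Schedule.mem_active {S : Schedule I} {j : Fin I.size} :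
    j ∈ S.active t ↔ I.release j ≤ t ∧ workDone (S.rate j) t < I.work j := by
  rw [S.active_eq_activeSet, mem_activeSet]

theorem Schedule.admissible (S : Schedule I) : Admissible S.rate where
  nonneg := S.rate_nonneg
  intervalIntegrable j a b := (S.rate_integrable j a).symm.trans (S.rate_integrable j b)

theorem existsUnique_schedule_rate_eq (hf : ∀ A, 0 ≤ f A) (hf0 : ∀ A, ∀ j ∉ A, f A j = 0) :
    ∃! S : Schedule I, ∀ t j, S.rate j t = f (S.active t) j := by
  obtain ⟨x, hx, hxf⟩ := exists_followsRuleOn_univ hf hf0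
  let S : Schedule I :=
    { rate := x
      rate_nonneg := hx.nonneg
      rate_integrable := fun j t => hx.intervalIntegrable j 0 t
      rate_eq_zero := fun j t hj => by
        rw [hxf t (mem_univ t)]
        exact hf0 _ j (mt mem_activeSet.1 hj) }
  refine ⟨S, fun t j => ?_, fun S' hS' => Schedule.ext ?_⟩
  · rw [S.active_eq_activeSet]
    exact hxf t (mem_univ t) j
  · refine FollowsRuleOn.eq_of_univ S'.admissible hx (fun t _ j => ?_) hxf
    rw [hS', S'.active_eq_activeSet]

end Dynamics

section Latest

theorem card_filter_card_filter_lt {ι κ : Type*} [LinearOrder κ] {key : ι → κ} {A : Finset ι}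
    (hkey : InjOn key A) {k : ℕ} (hk : k ≤ A.card) :
    (A.filter fun j => (A.filter fun i => key j < key i).card < k).card = k := by
  let above : ι → ℕ := fun j => (A.filter fun i => key j < key i).card
  have habove_lt : ∀ {i j}, i ∈ A → key j < key i → above i < above j := fun hi hji =>
    Finset.card_lt_card <| (Finset.ssubset_iff_of_subset <|
      Finset.monotone_filter_right _ fun _ _ => hji.trans).2
        ⟨_, Finset.mem_filter.2 ⟨hi, hji⟩, fun h => (Finset.mem_filter.1 h).2.false⟩
  have hinj : InjOn above A := fun i hi j hj hij => by
    rcases lt_trichotomy (key i) (key j) with h | h | h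
    · exact absurd hij (habove_lt hj h).ne'
    · exact hkey hi hj h
    · exact absurd hij (habove_lt hi h).ne
  have himage : A.image above = Finset.range A.card := by
    refine Finset.eq_of_subset_of_card_le (Finset.image_subset_iff.2 fun j hj => ?_)
      (by rw [Finset.card_range, Finset.card_image_of_injOn hinj])
    exact Finset.mem_range.2 <| Finset.card_lt_card <|
      Finset.filter_ssubset.2 ⟨j, hj, lt_irrefl _⟩
  calc (A.filter fun j => above j < k).card
      = ((A.filter fun j => above j < k).image above).card :=
        (Finset.card_image_of_injOn (hinj.mono (Finset.filter_subset _ A))).symm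
    _ = ((Finset.range A.card).filter (· < k)).card := by
        rw [← himage, Finset.filter_image]
    _ = k := by
        rw [show (Finset.range A.card).filter (· < k) = Finset.range k by grind,
          Finset.card_range]

variable {m : ℕ} {r : Fin m → ℝ} {A : Finset (Fin m)} {k : ℕ}

theorem later_iff_toLex_lt {i j : Fin m} : Later r i j ↔ toLex (r j, j) < toLex (r i, i) := by
  rw [Prod.Lex.toLex_lt_toLex, Later]

theorem latest_subset : latest r A k ⊆ A :=
  Finset.filter_subset _ _

theorem card_latest (hk : k ≤ A.card) : (latest r A k).card = k := by
  have hinj : InjOn (fun j => toLex (r j, j)) A := fun i _ j _ hij =>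
    congrArg (fun q => (ofLex q).2) hij
  refine Eq.trans ?_ (card_filter_card_filter_lt hinj hk)
  simp only [latest, later_iff_toLex_lt]

end Latest

section Rule

variable {I : JobSequence} {α δ β : ℝ}

/-- The number of latest active jobs that share the processor when `n` jobs are active. -/
def lapsShare (β : ℝ) (n : ℕ) : ℕ := ⌈β * n⌉₊

theorem lapsShare_le (hβ1 : β ≤ 1) (n : ℕ) : lapsShare β n ≤ n :=
  Nat.ceil_le.2 (mul_le_of_le_one_left n.cast_nonneg hβ1)

open Classical in
/-- The rate at which LAPS(δ, β) processes job `j` when `A` is the set of active jobs. -/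
def lapsRate (α δ β : ℝ) (A : Finset (Fin I.size)) (j : Fin I.size) : ℝ :=
  if j ∈ latest I.release A (lapsShare β A.card) then
    (1 + δ) * (A.card : ℝ) ^ (1 / α) / lapsShare β A.card else 0

theorem lapsRate_of_mem {A : Finset (Fin I.size)} {j : Fin I.size}
    (hj : j ∈ latest I.release A (lapsShare β A.card)) :
    lapsRate α δ β A j = (1 + δ) * (A.card : ℝ) ^ (1 / α) / lapsShare β A.card :=
  if_pos hj

theorem lapsRate_of_notMem {A : Finset (Fin I.size)} {j : Fin I.size}
    (hj : j ∉ latest I.release A (lapsShare β A.card)) : lapsRate α δ β A j = 0 :=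
  if_neg hj

theorem lapsRate_nonneg (hδ : 0 ≤ 1 + δ) (A : Finset (Fin I.size)) : 0 ≤ lapsRate α δ β A := by
  intro j
  unfold lapsRate
  split_ifs
  exacts [by positivity, le_rfl]

theorem sum_lapsRate (hα : 0 < α) (hβ0 : 0 < β) (hβ1 : β ≤ 1) (A : Finset (Fin I.size)) :
    ∑ j, lapsRate α δ β A j = (1 + δ) * (A.card : ℝ) ^ (1 / α) := by
  classical
  simp only [lapsRate, Finset.sum_ite_mem, Finset.univ_inter, Finset.sum_const,
    card_latest (lapsShare_le hβ1 _), nsmul_eq_mul]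
  rcases A.card.eq_zero_or_pos with hA | hA
  · simp [hA, Real.zero_rpow (inv_ne_zero hα.ne')]
  · have hshare : 0 < lapsShare β A.card := Nat.ceil_pos.2 (by positivity)
    field_simp

theorem followsLAPS_iff (hα : 0 < α) (hβ0 : 0 < β) (hβ1 : β ≤ 1) {S : Schedule I} :
    FollowsLAPS α δ β S ↔ ∀ t j, S.rate j t = lapsRate α δ β (S.active t) j := by
  refine ⟨fun hS t j => ?_, fun hS => ?_⟩
  · by_cases hj : j ∈ latest I.release (S.active t) (lapsShare β (S.active t).card)
    · rw [lapsRate_of_mem hj, hS.rate_eq_of_mem t j hj, hS.speed_eq, lapsShare]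
    · rw [lapsRate_of_notMem hj, hS.rate_eq_of_notMem t j hj]
  · have hspeed : ∀ t, S.speed t = (1 + δ) * ((S.active t).card : ℝ) ^ (1 / α) := fun t => by
      simp only [Schedule.speed, hS, sum_lapsRate hα hβ0 hβ1]
    refine ⟨hspeed, fun t j hj => ?_, fun t j hj => ?_⟩
    · rw [hS, hspeed]
      exact lapsRate_of_mem hj
    · rw [hS]
      exact lapsRate_of_notMem hj

theorem existsUnique_followsLAPS (hα : 0 < α) (hδ : 0 ≤ 1 + δ) (hβ0 : 0 < β) (hβ1 : β ≤ 1)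
    (I : JobSequence) : ∃! S : Schedule I, FollowsLAPS α δ β S := by
  simp only [followsLAPS_iff hα hβ0 hβ1]
  exact existsUnique_schedule_rate_eq (lapsRate_nonneg hδ) fun A j hj =>
    lapsRate_of_notMem fun h => hj (latest_subset h)

end Rule

section Flow

variable {I : JobSequence}

namespace Schedule

theorem workDone_le_work (S : Schedule I) (j : Fin I.size) (t : ℝ) :
    workDone (S.rate j) t ≤ I.work j := by
  by_contra! hlt
  have hmono := S.admissible.monotone_workDone j
  have h0 : workDone (S.rate j) 0 ≤ I.work j := by
    rw [workDone_zero]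
    exact (I.work_pos j).le
  have ht : 0 ≤ t := (hmono.reflect_lt (h0.trans_lt hlt)).le
  obtain ⟨s, hs, hsW⟩ := intermediate_value_Icc ht
    (S.admissible.continuous_workDone j).continuousOn ⟨h0, hlt.le⟩
  have hidle : ∫ u in s..t, S.rate j u = 0 := by
    refine intervalIntegral.integral_zero_ae (ae_of_all _ fun u hu => ?_)
    rw [uIoc_of_le hs.2] at hu
    exact S.rate_eq_zero j u fun hact => (hsW.symm.trans_le (hmono hu.1.le)).not_gt hact.2
  rw [← workDone_add_integral (S.admissible.intervalIntegrable j) s t, hsW, hidle, add_zero] at hlt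
  exact hlt.false

theorem measurableSet_mem_active (S : Schedule I) (j : Fin I.size) :
    MeasurableSet {t | j ∈ S.active t} := by
  simp only [mem_active]
  exact measurableSet_Ici.inter
    (isOpen_lt (S.admissible.continuous_workDone j) continuous_const).measurableSet

theorem flowTime_eq_volume (S : Schedule I) (j : Fin I.size) :
    S.flowTime j = volume {t | j ∈ S.active t} := by
  simp only [mem_active]
  refine le_antisymm (ENNReal.le_of_forall_nnreal_lt fun s hs => ?_) (le_iInf₂ fun t ht => ?_)
  · have hactive : Ico (I.release j) (I.release j + s) ⊆
        {t | I.release j ≤ t ∧ workDone (S.rate j) t < I.work j} := fun t ht => by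
      refine ⟨ht.1, ?_⟩
      by_contra! hcompleted
      have hflow : S.flowTime j ≤ s :=
        (iInf₂_le t ⟨ht.1, hcompleted⟩).trans (ENNReal.ofReal_le_of_le_toReal
          (sub_le_iff_le_add'.2 ht.2.le))
      exact hs.not_ge hflow
    simpa using measure_mono (μ := volume) hactive
  · have hactive : {u | I.release j ≤ u ∧ workDone (S.rate j) u < I.work j} ⊆
        Ico (I.release j) t := fun u hu =>
      ⟨hu.1, (S.admissible.monotone_workDone j).reflect_lt (hu.2.trans_le ht.2)⟩
    simpa using measure_mono (μ := volume) hactive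

theorem card_active_eq_sum_indicator {R : Type*} [Semiring R] (S : Schedule I) (t : ℝ) :
    ((S.active t).card : R) = ∑ j, {u | j ∈ S.active u}.indicator 1 t := by
  classical
  simp [indicator]

theorem totalFlow_eq_lintegral (S : Schedule I) :
    S.totalFlow = ∫⁻ t in Ici (0 : ℝ), ENNReal.ofReal (S.active t).card := by
  simp only [ENNReal.ofReal_natCast]
  simp only [card_active_eq_sum_indicator]
  rw [lintegral_finsetSum _ fun j _ => measurable_one.indicator (S.measurableSet_mem_active j)]
  refine Finset.sum_congr rfl fun j _ => ?_
  rw [lintegral_indicator_one (S.measurableSet_mem_active j), S.flowTime_eq_volume,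
    Measure.restrict_apply (S.measurableSet_mem_active j), inter_eq_left.2]
  exact fun t ht => (I.release_nonneg j).trans (mem_active.1 ht).1

theorem measurable_card_active (S : Schedule I) : Measurable fun t => ((S.active t).card : ℝ) := by
  simp only [card_active_eq_sum_indicator]
  exact Finset.measurable_sum _ fun j _ =>
    measurable_one.indicator (S.measurableSet_mem_active j)

theorem intervalIntegrable_card_active (S : Schedule I) (a b : ℝ) :
    IntervalIntegrable (fun t => ((S.active t).card : ℝ)) volume a b := by
  refine (intervalIntegrable_const (c := (I.size : ℝ))).mono_fun
    S.measurable_card_active.aestronglyMeasurable (ae_of_all _ fun t => ?_)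
  simpa using Finset.card_le_univ (S.active t)

theorem speed_nonneg (S : Schedule I) (t : ℝ) : 0 ≤ S.speed t :=
  Finset.sum_nonneg fun j _ => S.rate_nonneg j t

theorem intervalIntegrable_speed_rpow {α : ℝ} {S : Schedule I} (hS : S.energy α ≠ ∞) {b : ℝ}
    (hb : 0 ≤ b) : IntervalIntegrable (fun t => S.speed t ^ α) volume 0 b := by
  have hspeed : IntervalIntegrable S.speed volume 0 b :=
    (IntervalIntegrable.sum Finset.univ fun j _ => S.rate_integrable j b).congr
      fun t _ => Finset.sum_apply t _ _
  rw [intervalIntegrable_iff_integrableOn_Ioc_of_le hb]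
  refine ⟨(hspeed.1.aemeasurable.pow_const α).aestronglyMeasurable, ?_⟩
  rw [hasFiniteIntegral_iff_ofReal (ae_of_all _ fun t => Real.rpow_nonneg (S.speed_nonneg t) α)]
  exact (lintegral_mono_set fun t ht => ht.1.le).trans_lt hS.lt_top

theorem cost_eq_lintegral (α : ℝ) (S : Schedule I) :
    S.cost α = ∫⁻ t in Ici (0 : ℝ), ENNReal.ofReal ((S.active t).card + S.speed t ^ α) := by
  rw [cost, totalFlow_eq_lintegral, energy,
    ← lintegral_add_left S.measurable_card_active.ennreal_ofReal]
  exact lintegral_congr fun t =>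
    (ENNReal.ofReal_add (Nat.cast_nonneg _) (Real.rpow_nonneg (S.speed_nonneg t) α)).symm

end Schedule

theorem FollowsLAPS.cost_eq {α δ β : ℝ} (hα : 0 < α) (hδ : 0 ≤ 1 + δ) {S : Schedule I}
    (hS : FollowsLAPS α δ β S) :
    S.cost α = ENNReal.ofReal (1 + (1 + δ) ^ α) * S.totalFlow := by
  have hpower : ∀ t, S.speed t ^ α = (1 + δ) ^ α * (S.active t).card := fun t => by
    rw [hS.speed_eq, Real.mul_rpow hδ (by positivity), ← Real.rpow_mul (Nat.cast_nonneg _),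
      one_div_mul_cancel hα.ne', Real.rpow_one]
  rw [S.cost_eq_lintegral, S.totalFlow_eq_lintegral,
    ← lintegral_const_mul' _ _ ENNReal.ofReal_ne_top]
  refine lintegral_congr fun t => ?_
  rw [hpower, ← ENNReal.ofReal_mul (by positivity), one_add_mul]

end Flow

section Amortization

variable {I : JobSequence} {S O : Schedule I} {α δ β : ℝ} {t : ℝ} {j : Fin I.size}

namespace Schedule

open Classical in
/-- The number of jobs that are not later than `j` and not completed by time `t`. Once `j` is
released, all of them are active; counting unreleased jobs before that makes the rank a
nonincreasing function of time. -/
def rank (S : Schedule I) (j : Fin I.size) (t : ℝ) : ℕ :=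
  (Finset.univ.filter fun i => ¬ Later I.release i j ∧ ¬ S.CompletedBy i t).card

theorem antitone_rank (S : Schedule I) (j : Fin I.size) : Antitone (S.rank j) := by
  classical
  exact fun s t hst => Finset.card_le_card <| Finset.monotone_filter_right _ fun i _ hi =>
    ⟨hi.1, fun hs => hi.2 (hs.trans (S.admissible.monotone_workDone i hst))⟩

theorem antitone_rank_rpow (S : Schedule I) (j : Fin I.size) {e : ℝ} (he : 0 ≤ e) :
    Antitone fun t => (S.rank j t : ℝ) ^ e := fun _ _ hst =>
  Real.rpow_le_rpow (Nat.cast_nonneg _) (Nat.cast_le.2 (S.antitone_rank j hst)) he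

theorem rank_le_card_active (hj : I.release j ≤ t) : S.rank j t ≤ (S.active t).card := by
  classical
  refine Finset.card_le_card fun i hi => ?_
  obtain ⟨hlater, hcompleted⟩ := (Finset.mem_filter.1 hi).2
  exact mem_active.2 ⟨(not_lt.1 (not_or.1 hlater).1).trans hj, not_le.1 hcompleted⟩

theorem card_active_lt_rank_add {k : ℕ} (hj : j ∈ latest I.release (S.active t) k) :
    (S.active t).card < S.rank j t + k := by
  classical
  have hlater : ((S.active t).filter fun i => Later I.release i j).card < k :=
    (Finset.mem_filter.1 hj).2
  have hrank : ((S.active t).filter fun i => ¬ Later I.release i j).card ≤ S.rank j t :=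
    Finset.card_le_card fun i hi => by
      obtain ⟨hactive, hnotLater⟩ := Finset.mem_filter.1 hi
      exact Finset.mem_filter.2
        ⟨Finset.mem_univ i, hnotLater, not_le.2 (mem_active.1 hactive).2⟩
  have hsplit := Finset.card_filter_add_card_filter_not (s := S.active t)
    fun i => Later I.release i j
  omega

open Classical in
/-- The jobs on which `S` lags behind `O`: by time `t`, `S` has done less work on them. -/
def lagging (S O : Schedule I) (t : ℝ) : Finset (Fin I.size) :=
  Finset.univ.filter fun j => workDone (S.rate j) t < workDone (O.rate j) t

theorem mem_lagging : j ∈ S.lagging O t ↔ workDone (S.rate j) t < workDone (O.rate j) t := by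
  simp [lagging]

theorem workDone_eq_zero_of_le_release (S : Schedule I) (ht : t ≤ I.release j) :
    workDone (S.rate j) t = 0 := by
  rw [workDone_congr_of_lt (h := fun _ => 0) (I.release_nonneg j) ht fun u hu =>
    S.rate_eq_zero j u fun hact => hact.1.not_gt hu]
  exact intervalIntegral.integral_zero

theorem lagging_subset_active : S.lagging O t ⊆ S.active t := fun j hj => by
  rw [mem_lagging] at hj
  refine mem_active.2 ⟨?_, hj.trans_le (O.workDone_le_work j t)⟩
  by_contra! ht
  rw [S.workDone_eq_zero_of_le_release ht.le, O.workDone_eq_zero_of_le_release ht.le] at hj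
  exact hj.false

theorem active_sdiff_lagging_subset : S.active t \ S.lagging O t ⊆ O.active t := fun j hj => by
  rw [Finset.mem_sdiff, mem_active, mem_lagging, not_lt] at hj
  exact mem_active.2 ⟨hj.1.1, hj.2.trans_lt hj.1.2⟩

/-- The rate at which the lag of `S` behind `O` on job `j`, that is, the positive part of the
difference of the work done by `O` and by `S`, grows at time `t`. -/
def lagRate (S O : Schedule I) (j : Fin I.size) (t : ℝ) : ℝ :=
  {u | j ∈ S.lagging O u}.indicator (O.rate j - S.rate j) t

theorem sum_mul_lagRate (w : Fin I.size → ℝ) :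
    ∑ j, w j * S.lagRate O j t = ∑ j ∈ S.lagging O t, w j * (O.rate j t - S.rate j t) := by
  classical
  simp [lagRate, indicator, Finset.sum_ite_mem]

theorem lagging_eq_workDone_sub_pos (S O : Schedule I) (j : Fin I.size) :
    {u | j ∈ S.lagging O u} = {u | 0 < workDone (O.rate j - S.rate j) u} := by
  ext u
  have hsub : workDone (O.rate j - S.rate j) u = workDone (O.rate j) u - workDone (S.rate j) u :=
    intervalIntegral.integral_sub (O.rate_integrable j u) (S.rate_integrable j u)
  simp only [mem_lagging, mem_ofPred_eq, hsub, sub_pos]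

theorem intervalIntegrable_lagRate (S O : Schedule I) (j : Fin I.size) (a b : ℝ) :
    IntervalIntegrable (S.lagRate O j) volume a b := by
  have hmeas : MeasurableSet {u | j ∈ S.lagging O u} := by
    simp only [mem_lagging]
    exact (isOpen_lt (S.admissible.continuous_workDone j)
      (O.admissible.continuous_workDone j)).measurableSet
  rw [intervalIntegrable_iff]
  exact (intervalIntegrable_iff.1 ((O.admissible.intervalIntegrable j a b).sub
    (S.admissible.intervalIntegrable j a b))).indicator hmeas

theorem integral_lagRate_nonneg (S O : Schedule I) (j : Fin I.size) (T : ℝ) :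
    0 ≤ ∫ u in (0 : ℝ)..T, S.lagRate O j u := by
  unfold lagRate
  rw [lagging_eq_workDone_sub_pos,
    integral_indicator_workDone_pos (g := O.rate j - S.rate j) fun a b =>
      (O.admissible.intervalIntegrable j a b).sub (S.admissible.intervalIntegrable j a b)]
  exact le_max_right _ _

theorem integral_rank_rpow_mul_lagRate_nonneg (S O : Schedule I) (j : Fin I.size) {e T : ℝ}
    (he : 0 ≤ e) (hT : 0 ≤ T) :
    0 ≤ ∫ u in (0 : ℝ)..T, (S.rank j u : ℝ) ^ e * S.lagRate O j u :=
  intervalIntegral_antitone_mul_nonneg hT (S.intervalIntegrable_lagRate O j 0 T)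
    (fun b _ => S.integral_lagRate_nonneg O j b) (S.antitone_rank_rpow j he)
    fun _ => Real.rpow_nonneg (Nat.cast_nonneg _) e

theorem intervalIntegrable_rank_rpow_mul_lagRate (S O : Schedule I) (j : Fin I.size) {e T : ℝ}
    (he : 0 ≤ e) (hT : 0 ≤ T) :
    IntervalIntegrable (fun u => (S.rank j u : ℝ) ^ e * S.lagRate O j u) volume 0 T :=
  intervalIntegrable_antitone_mul hT (S.intervalIntegrable_lagRate O j 0 T)
    (S.antitone_rank_rpow j he) fun _ => Real.rpow_nonneg (Nat.cast_nonneg _) e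

end Schedule

theorem one_sub_one_div_nonneg (hα : 1 ≤ α) : 0 ≤ 1 - 1 / α :=
  sub_nonneg.2 ((div_le_one (by positivity)).2 hα)

theorem rpow_mul_le_rpow_div_add {s n : ℝ} (hα : 1 ≤ α) (hs : 0 ≤ s) (hn : 0 ≤ n) :
    n ^ (1 - 1 / α) * s ≤ s ^ α / α + (1 - 1 / α) * n := by
  have hα0 : 0 < α := by positivity
  have hamgm := Real.geom_mean_le_arith_mean2_weighted (w₁ := 1 / α) (w₂ := 1 - 1 / α)
    (by positivity) (one_sub_one_div_nonneg hα) (Real.rpow_nonneg hs α) hn (by ring)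
  rw [← Real.rpow_mul hs, mul_one_div_cancel hα0.ne', Real.rpow_one] at hamgm
  linarith [one_div_mul_eq_div α (s ^ α)]

theorem Schedule.sum_lagging_rank_rpow_mul_rate_le (hα : 1 ≤ α) (S O : Schedule I) (t : ℝ) :
    ∑ j ∈ S.lagging O t, (S.rank j t : ℝ) ^ (1 - 1 / α) * O.rate j t ≤
      O.speed t ^ α / α + (1 - 1 / α) * (S.active t).card := by
  have he := one_sub_one_div_nonneg hα
  calc ∑ j ∈ S.lagging O t, (S.rank j t : ℝ) ^ (1 - 1 / α) * O.rate j t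
      ≤ ∑ j ∈ S.lagging O t, ((S.active t).card : ℝ) ^ (1 - 1 / α) * O.rate j t := by
        gcongr with j hj
        · exact O.rate_nonneg j t
        · exact rank_le_card_active (mem_active.1 (lagging_subset_active hj)).1
    _ ≤ ∑ j, ((S.active t).card : ℝ) ^ (1 - 1 / α) * O.rate j t :=
        Finset.sum_le_univ_sum_of_nonneg fun j =>
          mul_nonneg (by positivity) (O.rate_nonneg j t)
    _ = ((S.active t).card : ℝ) ^ (1 - 1 / α) * O.speed t := (Finset.mul_sum _ _ _).symm
    _ ≤ O.speed t ^ α / α + (1 - 1 / α) * (S.active t).card :=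
        rpow_mul_le_rpow_div_add hα (O.speed_nonneg t) (Nat.cast_nonneg _)

/-- The coefficient of the number of active jobs in the rate at which LAPS(δ, β) decreases the
rank-weighted lag when it lags behind on all the jobs that it processes. -/
def lapsGain (α δ β : ℝ) : ℝ := (1 + δ) * (1 - β) ^ (1 - 1 / α)

theorem lapsGain_nonneg (hδ : 0 ≤ 1 + δ) (hβ1 : β ≤ 1) : 0 ≤ lapsGain α δ β :=
  mul_nonneg hδ (Real.rpow_nonneg (sub_nonneg.2 hβ1) _)

theorem lapsGain_le (hα : 1 ≤ α) (hδ : 0 ≤ 1 + δ) (hβ0 : 0 ≤ β) (hβ1 : β ≤ 1) :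
    lapsGain α δ β ≤ 1 + δ :=
  mul_le_of_le_one_right hδ <| Real.rpow_le_one (sub_nonneg.2 hβ1) (sub_le_self _ hβ0)
    (one_sub_one_div_nonneg hα)

theorem lapsGain_mul_div_le (hα : 1 ≤ α) (hδ : 0 ≤ 1 + δ) (hβ0 : 0 < β) (hβ1 : β ≤ 1)
    (hj : j ∈ latest I.release (S.active t) (lapsShare β (S.active t).card)) :
    lapsGain α δ β * (S.active t).card / lapsShare β (S.active t).card ≤
      (S.rank j t : ℝ) ^ (1 - 1 / α) * lapsRate α δ β (S.active t) j := by
  have he := one_sub_one_div_nonneg hα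
  have hcard : ((S.active t).card : ℝ) + 1 ≤ S.rank j t + lapsShare β (S.active t).card := by
    exact_mod_cast Schedule.card_active_lt_rank_add hj
  set n : ℝ := ((S.active t).card : ℝ)
  have hn : 0 ≤ n := Nat.cast_nonneg _
  have hrank : (1 - β) * n ≤ S.rank j t := by
    have hceil : (lapsShare β (S.active t).card : ℝ) < β * n + 1 :=
      Nat.ceil_lt_add_one (by positivity)
    linarith
  calc lapsGain α δ β * n / lapsShare β (S.active t).card
      = ((1 - β) * n) ^ (1 - 1 / α) * ((1 + δ) * n ^ (1 / α) / lapsShare β (S.active t).card) := by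
        have hsplit : n ^ (1 - 1 / α) * n ^ (1 / α) = n := by
          rw [← Real.rpow_add_of_nonneg hn he (by positivity), sub_add_cancel, Real.rpow_one]
        rw [Real.mul_rpow (sub_nonneg.2 hβ1) hn, lapsGain]
        linear_combination (-(1 + δ) * (1 - β) ^ (1 - 1 / α) /
          lapsShare β (S.active t).card) * hsplit
    _ ≤ (S.rank j t : ℝ) ^ (1 - 1 / α) * lapsRate α δ β (S.active t) j := by
        rw [lapsRate_of_mem hj]
        have := mul_nonneg (sub_nonneg.2 hβ1) hn
        gcongr

theorem lapsShare_le_card_latest_inter_lagging_add (hβ1 : β ≤ 1) :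
    lapsShare β (S.active t).card ≤
      (latest I.release (S.active t) (lapsShare β (S.active t).card) ∩ S.lagging O t).card +
        (O.active t).card := by
  nth_rw 1 [← card_latest (r := I.release) (lapsShare_le hβ1 (S.active t).card),
    ← Finset.card_inter_add_card_sdiff _ (S.lagging O t)]
  gcongr
  exact (Finset.sdiff_subset_sdiff latest_subset le_rfl).trans
    Schedule.active_sdiff_lagging_subset

theorem lapsGain_mul_card_sub_le (hα : 1 ≤ α) (hδ : 0 ≤ 1 + δ) (hβ0 : 0 < β) (hβ1 : β ≤ 1)
    (S O : Schedule I) (t : ℝ) :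
    lapsGain α δ β * (S.active t).card - lapsGain α δ β / β * (O.active t).card ≤
      ∑ j ∈ S.lagging O t, (S.rank j t : ℝ) ^ (1 - 1 / α) * lapsRate α δ β (S.active t) j := by
  have hterm : ∀ j, 0 ≤ (S.rank j t : ℝ) ^ (1 - 1 / α) * lapsRate α δ β (S.active t) j :=
    fun j => mul_nonneg (by positivity) (lapsRate_nonneg hδ _ j)
  have hgain := lapsGain_nonneg (α := α) hδ hβ1
  rcases (S.active t).card.eq_zero_or_pos with hn | hn
  · rw [hn, Nat.cast_zero, mul_zero, zero_sub]
    exact (neg_nonpos.2 (by positivity)).trans (Finset.sum_nonneg fun j _ => hterm j)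
  set n : ℝ := ((S.active t).card : ℝ)
  set k := lapsShare β (S.active t).card
  have hn0 : 0 < n := Nat.cast_pos.2 hn
  have hk : β * n ≤ k := Nat.le_ceil _
  have hk0 : (0 : ℝ) < k := (mul_pos hβ0 hn0).trans_le hk
  calc lapsGain α δ β * n - lapsGain α δ β / β * (O.active t).card
      = lapsGain α δ β * n - lapsGain α δ β * n / (β * n) * (O.active t).card := by
        rw [mul_div_mul_right _ _ hn0.ne']
    _ ≤ lapsGain α δ β * n - lapsGain α δ β * n / k * (O.active t).card := by gcongr
    _ = (k - (O.active t).card) * (lapsGain α δ β * n / k) := by field_simp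
    _ ≤ (latest I.release (S.active t) k ∩ S.lagging O t).card *
          (lapsGain α δ β * n / k) := by
        gcongr
        rw [sub_le_iff_le_add]
        exact_mod_cast lapsShare_le_card_latest_inter_lagging_add hβ1
    _ = ∑ _j ∈ latest I.release (S.active t) k ∩ S.lagging O t, lapsGain α δ β * n / k := by
        rw [Finset.sum_const, nsmul_eq_mul]
    _ ≤ ∑ j ∈ latest I.release (S.active t) k ∩ S.lagging O t,
          (S.rank j t : ℝ) ^ (1 - 1 / α) * lapsRate α δ β (S.active t) j :=
        Finset.sum_le_sum fun j hj =>
          lapsGain_mul_div_le hα hδ hβ0 hβ1 (Finset.mem_inter.1 hj).1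
    _ ≤ ∑ j ∈ S.lagging O t, (S.rank j t : ℝ) ^ (1 - 1 / α) * lapsRate α δ β (S.active t) j :=
        Finset.sum_le_sum_of_subset_of_nonneg Finset.inter_subset_right fun j _ _ => hterm j

theorem FollowsLAPS.sum_rank_rpow_mul_lagRate_le (hα : 1 ≤ α) (hδ : 0 ≤ 1 + δ) (hβ0 : 0 < β)
    (hβ1 : β ≤ 1) (hS : FollowsLAPS α δ β S) (O : Schedule I) (t : ℝ) :
    ∑ j, (S.rank j t : ℝ) ^ (1 - 1 / α) * S.lagRate O j t ≤
      O.speed t ^ α / α + lapsGain α δ β / β * (O.active t).card -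
        (lapsGain α δ β - (1 - 1 / α)) * (S.active t).card := by
  have hrate := (followsLAPS_iff (by positivity) hβ0 hβ1).1 hS t
  simp only [Schedule.sum_mul_lagRate, hrate, mul_sub, Finset.sum_sub_distrib]
  linarith [S.sum_lagging_rank_rpow_mul_rate_le hα O t,
    lapsGain_mul_card_sub_le hα hδ hβ0 hβ1 S O t]

end Amortization

section Competitive

variable {I : JobSequence} {S : Schedule I} {α δ β : ℝ}

/-- The bound that the amortized analysis gives for the ratio of the total flow time of
LAPS(δ, β) to the optimal cost. It is meaningful only for `1 - 1 / α < lapsGain α δ β`. -/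
def flowRatio (α δ β : ℝ) : ℝ :=
  max (1 / α) (lapsGain α δ β / β) / (lapsGain α δ β - (1 - 1 / α))

theorem one_add_nonneg_of_lt_lapsGain (hα : 1 ≤ α) (hβ1 : β ≤ 1)
    (hgain : 1 - 1 / α < lapsGain α δ β) : 0 ≤ 1 + δ :=
  (pos_of_mul_pos_left ((one_sub_one_div_nonneg hα).trans_lt hgain)
    (Real.rpow_nonneg (sub_nonneg.2 hβ1) _)).le

theorem one_le_flowRatio (hα : 1 ≤ α) (hβ0 : 0 < β) (hβ1 : β ≤ 1)
    (hgain : 1 - 1 / α < lapsGain α δ β) : 1 ≤ flowRatio α δ β := by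
  have he := one_sub_one_div_nonneg hα
  rw [flowRatio, one_le_div (sub_pos.2 hgain)]
  calc lapsGain α δ β - (1 - 1 / α) ≤ lapsGain α δ β := sub_le_self _ he
    _ ≤ lapsGain α δ β / β := le_div_self (he.trans hgain.le) hβ0 hβ1
    _ ≤ max (1 / α) (lapsGain α δ β / β) := le_max_right _ _

theorem FollowsLAPS.sum_rank_rpow_mul_lagRate_le_mul (hα : 1 ≤ α) (hβ0 : 0 < β) (hβ1 : β ≤ 1)
    (hgain : 1 - 1 / α < lapsGain α δ β) (hS : FollowsLAPS α δ β S) (O : Schedule I) (t : ℝ) :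
    ∑ j, (S.rank j t : ℝ) ^ (1 - 1 / α) * S.lagRate O j t ≤
      (lapsGain α δ β - (1 - 1 / α)) *
        (flowRatio α δ β * ((O.active t).card + O.speed t ^ α) - (S.active t).card) := by
  have hspeed := Real.rpow_nonneg (O.speed_nonneg t) α
  calc ∑ j, (S.rank j t : ℝ) ^ (1 - 1 / α) * S.lagRate O j t
      ≤ 1 / α * O.speed t ^ α + lapsGain α δ β / β * (O.active t).card -
          (lapsGain α δ β - (1 - 1 / α)) * (S.active t).card := by
        rw [one_div_mul_eq_div]
        exact hS.sum_rank_rpow_mul_lagRate_le hα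
          (one_add_nonneg_of_lt_lapsGain hα hβ1 hgain) hβ0 hβ1 O t
    _ ≤ max (1 / α) (lapsGain α δ β / β) * O.speed t ^ α +
          max (1 / α) (lapsGain α δ β / β) * (O.active t).card -
          (lapsGain α δ β - (1 - 1 / α)) * (S.active t).card := by
        gcongr
        · exact le_max_left _ _
        · exact le_max_right _ _
    _ = (lapsGain α δ β - (1 - 1 / α)) *
          (flowRatio α δ β * ((O.active t).card + O.speed t ^ α) - (S.active t).card) := by
        rw [mul_sub, ← mul_assoc, flowRatio, mul_div_cancel₀ _ (sub_pos.2 hgain).ne']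
        ring

theorem Schedule.integral_sum_rank_rpow_mul_lagRate_nonneg (S O : Schedule I) {e T : ℝ}
    (he : 0 ≤ e) (hT : 0 ≤ T) :
    0 ≤ ∫ u in (0 : ℝ)..T, ∑ j, (S.rank j u : ℝ) ^ e * S.lagRate O j u := by
  rw [intervalIntegral.integral_finsetSum fun j _ =>
    S.intervalIntegrable_rank_rpow_mul_lagRate O j he hT]
  exact Finset.sum_nonneg fun j _ => S.integral_rank_rpow_mul_lagRate_nonneg O j he hT

theorem FollowsLAPS.integral_card_active_le (hα : 1 ≤ α) (hβ0 : 0 < β) (hβ1 : β ≤ 1)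
    (hgain : 1 - 1 / α < lapsGain α δ β) (hS : FollowsLAPS α δ β S) {O : Schedule I}
    (hO : O.energy α ≠ ∞) {T : ℝ} (hT : 0 ≤ T) :
    ∫ u in (0 : ℝ)..T, ((S.active u).card : ℝ) ≤
      ∫ u in (0 : ℝ)..T, flowRatio α δ β * ((O.active u).card + O.speed u ^ α) := by
  have he := one_sub_one_div_nonneg hα
  have hintS := S.intervalIntegrable_card_active 0 T
  have hintO := ((O.intervalIntegrable_card_active 0 T).add
    (Schedule.intervalIntegrable_speed_rpow hO hT)).const_mul (flowRatio α δ β)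
  have hintLag : IntervalIntegrable
      (fun u => ∑ j, (S.rank j u : ℝ) ^ (1 - 1 / α) * S.lagRate O j u) volume 0 T :=
    (IntervalIntegrable.sum Finset.univ fun j _ =>
      S.intervalIntegrable_rank_rpow_mul_lagRate O j he hT).congr
        fun u _ => Finset.sum_apply u _ _
  have hdrift := (S.integral_sum_rank_rpow_mul_lagRate_nonneg O he hT).trans
    (intervalIntegral.integral_mono_on hT hintLag ((hintO.sub hintS).const_mul _) fun u _ =>
      hS.sum_rank_rpow_mul_lagRate_le_mul hα hβ0 hβ1 hgain O u)
  rw [intervalIntegral.integral_const_mul, intervalIntegral.integral_sub hintO hintS] at hdrift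
  exact sub_nonneg.1 (nonneg_of_mul_nonneg_right hdrift (sub_pos.2 hgain))

theorem FollowsLAPS.totalFlow_le (hα : 1 ≤ α) (hβ0 : 0 < β) (hβ1 : β ≤ 1)
    (hgain : 1 - 1 / α < lapsGain α δ β) (hS : FollowsLAPS α δ β S) (O : Schedule I) :
    S.totalFlow ≤ ENNReal.ofReal (flowRatio α δ β) * O.cost α := by
  have hratio : 0 < flowRatio α δ β := zero_lt_one.trans_le (one_le_flowRatio hα hβ0 hβ1 hgain)
  rcases eq_or_ne (O.energy α) ∞ with hO | hO
  · rw [Schedule.cost, hO, add_top, ENNReal.mul_top (ENNReal.ofReal_pos.2 hratio).ne']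
    exact le_top
  rw [S.totalFlow_eq_lintegral, O.cost_eq_lintegral,
    ← lintegral_const_mul' _ _ ENNReal.ofReal_ne_top]
  simp only [← ENNReal.ofReal_mul hratio.le]
  refine setLIntegral_Ici_le_of_intervalIntegral_le
    (fun b _ => S.intervalIntegrable_card_active 0 b)
    (fun b hb => ((O.intervalIntegrable_card_active 0 b).add
      (Schedule.intervalIntegrable_speed_rpow hO hb)).const_mul _)
    (fun t => Nat.cast_nonneg _)
    (fun t => mul_nonneg hratio.le
      (add_nonneg (Nat.cast_nonneg _) (Real.rpow_nonneg (O.speed_nonneg t) α)))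
    fun b hb => hS.integral_card_active_le hα hβ0 hβ1 hgain hO hb

theorem FollowsLAPS.cost_le (hα : 1 ≤ α) (hβ0 : 0 < β) (hβ1 : β ≤ 1)
    (hgain : 1 - 1 / α < lapsGain α δ β) (hS : FollowsLAPS α δ β S) :
    S.cost α ≤ ENNReal.ofReal (flowRatio α δ β * (1 + (1 + δ) ^ α)) * optCost α I := by
  have hδ := one_add_nonneg_of_lt_lapsGain hα hβ1 hgain
  rw [optCost, ENNReal.mul_iInf' (fun h => absurd h ENNReal.ofReal_ne_top) fun _ => ⟨S⟩]
  refine le_iInf fun O => ?_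
  rw [hS.cost_eq (by positivity) hδ, mul_comm (flowRatio α δ β),
    ENNReal.ofReal_mul (by positivity), mul_assoc]
  gcongr
  exact hS.totalFlow_le hα hβ0 hβ1 hgain O

theorem IsCompetitive.mono {c c' : ℝ} {ALG : (I : JobSequence) → Schedule I}
    (hALG : IsCompetitive α c ALG) (hcc' : c ≤ c') : IsCompetitive α c' ALG :=
  ⟨hALG.1.trans hcc', fun I => (hALG.2 I).trans (by gcongr)⟩

end Competitive

section Parameters

variable {α : ℝ}

theorem one_div_two_mul_le_one (hα : 1 ≤ α) : 1 / (2 * α) ≤ 1 :=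
  (div_le_one (by positivity)).2 (by linarith)

theorem one_add_one_div_le_lapsGain (hα : 1 ≤ α) :
    1 + 1 / α ≤ lapsGain α (3 / α) (1 / (2 * α)) := by
  have hα0 : 0 < α := by positivity
  have hβ : 0 < 1 - 1 / (2 * α) := by
    rw [sub_pos, div_lt_one (by positivity)]
    linarith
  calc 1 + 1 / α ≤ (1 + 3 / α) * (1 - 1 / (2 * α)) := by
        field_simp
        linarith
    _ ≤ lapsGain α (3 / α) (1 / (2 * α)) := by
        rw [lapsGain]
        gcongr
        exact Real.self_le_rpow_of_le_one hβ.le (sub_le_self _ (by positivity))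
          (sub_le_self _ (by positivity))

theorem one_sub_one_div_lt_lapsGain (hα : 1 ≤ α) :
    1 - 1 / α < lapsGain α (3 / α) (1 / (2 * α)) := by
  have hα0 : 0 < 1 / α := by positivity
  linarith [one_add_one_div_le_lapsGain hα]

theorem flowRatio_le (hα : 1 ≤ α) : flowRatio α (3 / α) (1 / (2 * α)) ≤ 4 * α ^ 3 := by
  have hα0 : 0 < α := by positivity
  have hle : lapsGain α (3 / α) (1 / (2 * α)) ≤ 4 :=
    (lapsGain_le hα (by positivity) (by positivity) (one_div_two_mul_le_one hα)).trans
      (by linarith [div_le_self zero_le_three hα])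
  have hgap : 2 / α ≤ lapsGain α (3 / α) (1 / (2 * α)) - (1 - 1 / α) := by
    linarith [one_add_one_div_le_lapsGain hα, add_div 1 1 α, one_add_one_eq_two (R := ℝ)]
  have hmax : max (1 / α) (lapsGain α (3 / α) (1 / (2 * α)) / (1 / (2 * α))) ≤ 8 * α := by
    refine max_le ((div_le_one hα0).2 hα |>.trans (by linarith)) ?_
    rw [div_div_eq_mul_div, div_one]
    nlinarith
  calc flowRatio α (3 / α) (1 / (2 * α)) ≤ 8 * α / (2 / α) := by
        unfold flowRatio
        gcongr
    _ = 4 * α ^ 2 := by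
        field_simp
        norm_num
    _ ≤ 4 * α ^ 3 := by
        gcongr
        norm_num

theorem one_add_div_rpow_le_exp {x : ℝ} (hα : 0 < α) (hx : 0 ≤ x) :
    (1 + x / α) ^ α ≤ Real.exp x := by
  calc (1 + x / α) ^ α ≤ Real.exp (x / α) ^ α := by
        gcongr
        linarith [Real.add_one_le_exp (x / α)]
    _ = Real.exp x := by rw [← Real.exp_mul, div_mul_cancel₀ _ hα.ne']

end Parameters

end SpeedScaling

end

open SpeedScaling in
theorem theorem1_general {α δ β : ℝ} (hα : 1 ≤ α) (hβ0 : 0 < β) (hβ1 : β ≤ 1)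
    (hgain : 1 - 1 / α < lapsGain α δ β) :
    ∃ LAPS : (I : JobSequence) → Schedule I,
      (∀ (I : JobSequence) (S : Schedule I), FollowsLAPS α δ β S ↔ S = LAPS I) ∧
      IsCompetitive α (flowRatio α δ β * (1 + (1 + δ) ^ α)) LAPS := by
  have hδ := one_add_nonneg_of_lt_lapsGain hα hβ1 hgain
  choose LAPS hLAPS huniq using fun I =>
    existsUnique_followsLAPS (zero_lt_one.trans_le hα) hδ hβ0 hβ1 I
  refine ⟨LAPS, fun I S => ⟨huniq I S, fun hS => hS ▸ hLAPS I⟩, ?_,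
    fun I => (hLAPS I).cost_le hα hβ0 hβ1 hgain⟩
  exact one_le_mul_of_one_le_of_one_le (one_le_flowRatio hα hβ0 hβ1 hgain)
    (le_add_of_nonneg_right (Real.rpow_nonneg hδ α))

open SpeedScaling in
/-- For every `α > 1`, LAPS(3/α, 1/(2α)) is well defined (for each job sequence exactly one
schedule follows it) and `c`-competitive with `c = 4 α³ (1 + (1 + 3/α) ^ α)`, and `c = O(α³)`. -/
theorem theorem1 :
    (∀ α : ℝ, 1 < α →
      ∃ LAPS : (I : JobSequence) → Schedule I,
        (∀ (I : JobSequence) (S : Schedule I),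
          FollowsLAPS α (3 / α) (1 / (2 * α)) S ↔ S = LAPS I) ∧
        IsCompetitive α (4 * α ^ 3 * (1 + (1 + 3 / α) ^ α)) LAPS) ∧
    ∃ C : ℝ, ∀ α : ℝ, 1 < α → 4 * α ^ 3 * (1 + (1 + 3 / α) ^ α) ≤ C * α ^ 3 := by
  refine ⟨fun α hα => ?_, 4 * (1 + Real.exp 3), fun α hα => ?_⟩
  · obtain ⟨LAPS, hLAPS, hcomp⟩ := theorem1_general hα.le (by positivity)
      (one_div_two_mul_le_one hα.le) (one_sub_one_div_lt_lapsGain hα.le)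
    exact ⟨LAPS, hLAPS, hcomp.mono (by gcongr; exact flowRatio_le hα.le)⟩
  · rw [mul_right_comm]
    gcongr
    exact one_add_div_rpow_le_exp (by positivity) zero_le_three
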